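/- Let $k\ge 1$, let $\lambda=(\lambda_1,\dots,\lambda_k)$ be a vector of strictly positive reals with $\sum_{i=1}^k\lambda_i=1$, and let $\sigma$ be a permutation of $\{1,\dots,k\}$. Put $a_i=\sum_{j<i}\lambda_j$ for $1\le i\le k+1$ and $X_i=[a_i,a_{i+1}[$ for $1\le i\le k$, and let $T:[0,1[\,\to[0,1[$ be the associated interval exchange transformation, that is, the bijection $$T(x)=x+\sum_{m<\sigma^{-1}(i)}\lambda_{\sigma(m)}-\sum_{m<i}\lambda_m\qquad (x\in X_i,\ 1\le i\le k).$$ Assume that $T$ is regular: if $T^n a_i=a_j$ with $i,j\in\{2,\dots,k\}$ and $n\in\mathbb Z$, then $n=0$ and $i=j$. For $x\in[0,1[$ let $U(x)=(U(x)_n)_{n\ge 0}$ be the infinite word over the alphabet $\{1,\dots,k\}$ with $U(x)_n=i$ if and only if $T^n(x)\in X_i$. Then for every $x\in[0,1[$ the word $U=U(x)$ has property $R_k$: it is recurrent (every finite factor of $U$ occurs in $U$ infinitely many times), and for every factor $w$ of $U$ (the empty word included) there are exactly $k$ return words over $w$, where a return word over $w$ is a word $U_iU_{i+1}\cdots U_{j-1}$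 such that $i<j$ are the positions of two consecutive occurrences of $w$ in $U$. -/

import Mathlib

/-- The data of an interval exchange of `k` intervals: a vector of `k` strictly positive lengths
with sum `1`, and a permutation of the `k` indices (here `0, …, k - 1`). -/
structure IntervalExchange (k : ℕ) where
  len : Fin k → ℝ
  perm : Equiv.Perm (Fin k)
  len_pos : ∀ i, 0 < len i
  sum_len : ∑ i, len i = 1

namespace IntervalExchange

variable {k : ℕ}

/-- The left endpoint `∑_{j < i} λ_j` of the `i`-th interval. -/
noncomputable def left (E : IntervalExchange k) (i : Fin k) : ℝ := ∑ j ∈ Finset.Iio i, E.len j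

/-- The right endpoint `∑_{j ≤ i} λ_j` of the `i`-th interval. -/
noncomputable def right (E : IntervalExchange k) (i : Fin k) : ℝ := ∑ j ∈ Finset.Iic i, E.len j

/-- The `i`-th interval `X_i = [∑_{j < i} λ_j, ∑_{j ≤ i} λ_j[` of the partition of `[0,1[`. -/
def X (E : IntervalExchange k) (i : Fin k) : Set ℝ := Set.Ico (E.left i) (E.right i)

/-- The translation `a_i = ∑_{m < σ⁻¹ i} λ_{σ m} - ∑_{m < i} λ_m` applied on `X_i`. -/
noncomputable def shift (E : IntervalExchange k) (i : Fin k) : ℝ :=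
  ∑ m ∈ Finset.Iio (E.perm.symm i), E.len (E.perm m) - ∑ m ∈ Finset.Iio i, E.len m

theorem right_eq (E : IntervalExchange k) (i : Fin k) : E.right i = E.left i + E.len i := by
  unfold right left
  rw [← Finset.Iio_insert, Finset.sum_insert (by simp), add_comm]

theorem left_nonneg (E : IntervalExchange k) (i : Fin k) : 0 ≤ E.left i :=
  Finset.sum_nonneg fun j _ => (E.len_pos j).le

theorem right_le_one (E : IntervalExchange k) (i : Fin k) : E.right i ≤ 1 := by
  rw [← E.sum_len]
  exact Finset.sum_le_sum_of_subset_of_nonneg (Finset.subset_univ _)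
    fun j _ _ => (E.len_pos j).le

theorem left_lt_one (E : IntervalExchange k) (i : Fin k) : E.left i < 1 := by
  have h1 := E.right_eq i
  have h2 := E.right_le_one i
  have h3 := E.len_pos i
  linarith

theorem right_le_left (E : IntervalExchange k) {i j : Fin k} (h : i < j) :
    E.right i ≤ E.left j := by
  refine Finset.sum_le_sum_of_subset_of_nonneg ?_ fun l _ _ => (E.len_pos l).le
  intro l hl
  simp only [Finset.mem_Iic, Finset.mem_Iio] at hl ⊢
  exact lt_of_le_of_lt hl h

theorem eq_of_mem_X (E : IntervalExchange k) {i j : Fin k} {y : ℝ} (hi : y ∈ E.X i)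
    (hj : y ∈ E.X j) : i = j := by
  rcases lt_trichotomy i j with h | h | h
  · exact absurd (hi.2.trans_le (E.right_le_left h)) (not_lt.mpr hj.1)
  · exact h
  · exact absurd (hj.2.trans_le (E.right_le_left h)) (not_lt.mpr hi.1)

theorem exists_mem_X (E : IntervalExchange k) (y : Set.Ico (0 : ℝ) 1) :
    ∃ i, (y : ℝ) ∈ E.X i := by
  by_contra hcon
  have key : ∀ n (hn : n < k), E.right ⟨n, hn⟩ ≤ y := by
    intro n
    induction n with
    | zero =>
      intro hn
      by_contra hlt
      refine hcon ⟨⟨0, hn⟩, ?_, not_le.mp hlt⟩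
      have h0 : (Finset.Iio (⟨0, hn⟩ : Fin k)) = ∅ := by
        ext l
        simp [Fin.lt_def]
      rw [left, h0, Finset.sum_empty]
      exact y.2.1
    | succ n ih =>
      intro hn
      by_contra hlt
      refine hcon ⟨⟨n + 1, hn⟩, ?_, not_le.mp hlt⟩
      have h0 : (Finset.Iio (⟨n + 1, hn⟩ : Fin k)) = Finset.Iic ⟨n, by omega⟩ := by
        ext l
        simp [Fin.lt_def, Fin.le_def, Nat.lt_succ_iff]
      rw [left, h0]
      exact ih (by omega)
  obtain _ | k := k
  · have h := E.sum_len
    simp at h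
  · have h := key k (by omega)
    have hu : (Finset.Iic (⟨k, by omega⟩ : Fin (k + 1))) = Finset.univ := by
      ext l
      simpa [Fin.le_def] using Nat.lt_succ_iff.mp l.2
    rw [right, hu, E.sum_len] at h
    exact absurd y.2.2 (not_lt.mpr h)

/-- The letter `i` such that `y ∈ X_i`. -/
noncomputable def code (E : IntervalExchange k) (y : Set.Ico (0 : ℝ) 1) : Fin k :=
  (E.exists_mem_X y).choose

theorem code_mem (E : IntervalExchange k) (y : Set.Ico (0 : ℝ) 1) : (y : ℝ) ∈ E.X (E.code y) :=
  (E.exists_mem_X y).choose_spec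

theorem code_eq_iff (E : IntervalExchange k) (y : Set.Ico (0 : ℝ) 1) (i : Fin k) :
    E.code y = i ↔ (y : ℝ) ∈ E.X i :=
  ⟨fun h => h ▸ E.code_mem y, fun h => E.eq_of_mem_X (E.code_mem y) h⟩

/-- The interval exchange with the exchanged intervals as its partition and the inverse
permutation; its transformation is the inverse one. -/
def inv (E : IntervalExchange k) : IntervalExchange k where
  len i := E.len (E.perm i)
  perm := E.perm.symm
  len_pos i := E.len_pos _
  sum_len := by rw [Equiv.sum_comp E.perm E.len, E.sum_len]

theorem inv_inv (E : IntervalExchange k) : E.inv.inv = E := by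
  cases E
  simp [inv]

theorem add_shift_mem (E : IntervalExchange k) {i : Fin k} {y : ℝ} (hy : y ∈ E.X i) :
    y + E.shift i ∈ E.inv.X (E.perm.symm i) := by
  have h1 := hy.1
  have h2 := hy.2
  have hs : E.shift i = E.inv.left (E.perm.symm i) - E.left i := rfl
  have hl : E.inv.len (E.perm.symm i) = E.len i := by simp [inv]
  rw [E.right_eq] at h2
  refine ⟨?_, ?_⟩
  · rw [hs]
    linarith
  · rw [E.inv.right_eq, hs, hl]
    linarith

/-- The map `T` of `[0,1[` to itself: `T x = x + a_i` for `x ∈ X_i`. -/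
noncomputable def map (E : IntervalExchange k) (x : Set.Ico (0 : ℝ) 1) : Set.Ico (0 : ℝ) 1 :=
  ⟨x + E.shift (E.code x),
    (E.inv.left_nonneg _).trans (E.add_shift_mem (E.code_mem x)).1,
    (E.add_shift_mem (E.code_mem x)).2.trans_le (E.inv.right_le_one _)⟩

theorem inv_map_map (E : IntervalExchange k) (x : Set.Ico (0 : ℝ) 1) :
    E.inv.map (E.map x) = x := by
  have hc : E.inv.code (E.map x) = E.perm.symm (E.code x) :=
    (E.inv.code_eq_iff _ _).2 (E.add_shift_mem (E.code_mem x))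
  have hs : E.inv.shift (E.perm.symm (E.code x)) = - E.shift (E.code x) := by
    simp [shift, inv]
  apply Subtype.ext
  change (x : ℝ) + E.shift (E.code x) + E.inv.shift (E.inv.code (E.map x)) = x
  rw [hc, hs]
  ring

/-- The interval exchange transformation `T`, as a bijection of `[0,1[`. -/
noncomputable def T (E : IntervalExchange k) : Equiv.Perm (Set.Ico (0 : ℝ) 1) where
  toFun := E.map
  invFun := E.inv.map
  left_inv := E.inv_map_map
  right_inv x := by
    have h := E.inv.inv_map_map x
    rwa [E.inv_inv] at h

/-- The left endpoint of `X_i` as a point of `[0,1[`. -/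
noncomputable def leftPt (E : IntervalExchange k) (i : Fin k) : Set.Ico (0 : ℝ) 1 :=
  ⟨E.left i, E.left_nonneg i, E.left_lt_one i⟩

/-- Regularity: with `i`, `j` ranging over all indices but the first (the endpoints strictly
inside `]0,1[`), `T ^ n a_i = a_j` with `n ∈ ℤ` implies `n = 0` and `i = j`. -/
def Regular (E : IntervalExchange k) : Prop :=
  ∀ i j : Fin k, (i : ℕ) ≠ 0 → (j : ℕ) ≠ 0 → ∀ n : ℤ,
    (E.T ^ n) (E.leftPt i) = E.leftPt j → n = 0 ∧ i = j

/-- The infinite word `U(x)` coding the positive orbit of `x`. -/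
noncomputable def word (E : IntervalExchange k) (x : Set.Ico (0 : ℝ) 1) : ℕ → Fin k :=
  fun n => E.code ((E.T ^ n) x)

end IntervalExchange

namespace InfiniteWord

variable {A : Type*}

/-- The finite word `U_i U_{i+1} ⋯ U_{i+n-1}`. -/
def block (U : ℕ → A) (i n : ℕ) : List A := List.ofFn fun m : Fin n => U (i + m)

/-- The set of positions of the first letters of the occurrences of `w` in `U`. -/
def positions (U : ℕ → A) (w : List A) : Set ℕ := {i | block U i w.length = w}

/-- The language of `U`: the set of its (finite) factors. -/
def language (U : ℕ → A) : Set (List A) := {w | (positions U w).Nonempty}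

/-- Every factor occurs infinitely many times. -/
def Recurrent (U : ℕ → A) : Prop := ∀ w ∈ language U, (positions U w).Infinite

/-- The return words over `w`: the words `U_i ⋯ U_{j-1}` where `i < j` are consecutive
occurrences of `w` in `U`. -/
def returnWords (U : ℕ → A) (w : List A) : Set (List A) :=
  {v | ∃ i ∈ positions U w, ∃ j ∈ positions U w, i < j ∧
    (∀ l, i < l → l < j → l ∉ positions U w) ∧ v = block U i (j - i)}

/-- Property `R_n`: `U` is recurrent, and the set of return words over each factor has exactly
`n` elements. -/
def PropertyR (n : ℕ) (U : ℕ → A) : Prop :=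
  Recurrent U ∧ ∀ w ∈ language U, (returnWords U w).encard = n

end InfiniteWord

namespace IntervalExchange

variable {k : ℕ}

/-! Let `k ≥ 2`. The points whose coding begins with `w` form an order-convex set, and occurrences
of `w` in `U(x)` are visits of the orbit of `x` to it. The return words are therefore the codings,
up to the first return, of the visited points.

Follow each nonzero left endpoint backwards, from time `|w|` on, to its first entry in the cylinder.
This gives `k - 1` cut points. Between consecutive cuts the return word is constant
(`returnWord_eq_of_le`). Two points separated by a cut, adjacent or not, have different return words
(`returnWord_ne_of_cutPt`). By regularity the cuts are distinct and differ from the least point of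
the cylinder, so there are exactly `k` pieces.

Recurrence, and the fact that every orbit visits every piece, come from density of forward orbits
(`Regular.exists_T_pow_mem_Ioo`). If the limit set of an orbit had a gap, the gap could be
transported along an infinite orbit. Only finitely many steps can shrink it, which leaves infinitely
many points of `[0,1[` at a fixed distance from one another. -/

theorem T_apply_coe (E : IntervalExchange k) (y : Set.Ico (0 : ℝ) 1) :
    (E.T y : ℝ) = y + E.shift (E.code y) := rfl

theorem T_pow_add_apply (E : IntervalExchange k) (m n : ℕ) (y : Set.Ico (0 : ℝ) 1) :
    (E.T ^ (m + n)) y = (E.T ^ m) ((E.T ^ n) y) := by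
  rw [pow_add]; rfl

theorem T_pow_succ_apply (E : IntervalExchange k) (n : ℕ) (y : Set.Ico (0 : ℝ) 1) :
    (E.T ^ (n + 1)) y = E.T ((E.T ^ n) y) := by
  rw [pow_succ']; rfl

theorem T_pow_succ_apply' (E : IntervalExchange k) (n : ℕ) (y : Set.Ico (0 : ℝ) 1) :
    (E.T ^ (n + 1)) y = (E.T ^ n) (E.T y) := by
  rw [pow_succ]; rfl

theorem T_inv (E : IntervalExchange k) : E.inv.T = E.T⁻¹ := by
  ext1 y
  rfl

theorem T_inv_pow_T_pow (E : IntervalExchange k) (n : ℕ) (y : Set.Ico (0 : ℝ) 1) :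
    (E.inv.T ^ n) ((E.T ^ n) y) = y := by
  rw [T_inv, inv_pow]; simp

theorem T_pow_T_inv_pow (E : IntervalExchange k) (n : ℕ) (y : Set.Ico (0 : ℝ) 1) :
    (E.T ^ n) ((E.inv.T ^ n) y) = y := by
  rw [T_inv, inv_pow]; simp

theorem code_leftPt (E : IntervalExchange k) (i : Fin k) : E.code (E.leftPt i) = i := by
  rw [code_eq_iff]
  refine ⟨le_rfl, ?_⟩
  have := E.right_eq i
  have := E.len_pos i
  change E.left i < E.right i
  linarith

theorem leftPt_injective (E : IntervalExchange k) : Function.Injective E.leftPt := fun i j h => by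
  rw [← E.code_leftPt i, h, E.code_leftPt]

theorem left_of_val_eq_zero (E : IntervalExchange k) {i : Fin k} (hi : (i : ℕ) = 0) :
    E.left i = 0 := by
  rw [left, Finset.sum_eq_zero]
  intro j hj
  have : (j : ℕ) < i := Fin.lt_def.1 (Finset.mem_Iio.1 hj)
  omega

theorem left_code_le (E : IntervalExchange k) (y : Set.Ico (0 : ℝ) 1) :
    E.left (E.code y) ≤ y := (E.code_mem y).1

theorem lt_left_code (E : IntervalExchange k) {y z : Set.Ico (0 : ℝ) 1} (h : (y : ℝ) ≤ z)
    (hc : E.code y ≠ E.code z) : (y : ℝ) < E.left (E.code z) := by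
  by_contra hlt
  exact hc ((E.code_eq_iff _ _).2 ⟨not_lt.1 hlt, h.trans_lt (E.code_mem z).2⟩)

/-! ### Points with a common initial coding, and the cuts that separate them -/

/-- The points `y` and `z` have the same first `N` letters. -/
def Agree (E : IntervalExchange k) (y z : Set.Ico (0 : ℝ) 1) (N : ℕ) : Prop :=
  ∀ s < N, E.code ((E.T ^ s) y) = E.code ((E.T ^ s) z)

theorem Agree.mono {E : IntervalExchange k} {y z : Set.Ico (0 : ℝ) 1} {M N : ℕ}
    (h : E.Agree y z N) (hM : M ≤ N) : E.Agree y z M := fun s hs => h s (hs.trans_le hM)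

theorem Agree.symm {E : IntervalExchange k} {y z : Set.Ico (0 : ℝ) 1} {N : ℕ}
    (h : E.Agree y z N) : E.Agree z y N := fun s hs => (h s hs).symm

theorem Agree.shift {E : IntervalExchange k} {y z : Set.Ico (0 : ℝ) 1} {M N s : ℕ}
    (h : E.Agree y z N) (hs : M + s ≤ N) : E.Agree ((E.T ^ s) y) ((E.T ^ s) z) M := by
  intro t ht
  rw [← T_pow_add_apply, ← T_pow_add_apply]
  exact h _ (by omega)

/-- Equal letters mean equal translations, so distances are preserved as long as the codings agree.
-/
theorem Agree.sub_eq {E : IntervalExchange k} {y z : Set.Ico (0 : ℝ) 1} {N : ℕ}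
    (h : E.Agree y z N) {s : ℕ} (hs : s ≤ N) :
    (((E.T ^ s) z : Set.Ico (0 : ℝ) 1) : ℝ) - ((E.T ^ s) y : Set.Ico (0 : ℝ) 1) = z - y := by
  induction s with
  | zero => simp
  | succ s ih =>
    rw [T_pow_succ_apply, T_pow_succ_apply, T_apply_coe, T_apply_coe, h s (by omega)]
    linarith [ih (by omega)]

/-- Each iterate moves the three points by the same translation, hence keeps them in order, and each
`X i` is an interval. -/
theorem Agree.of_mem_Icc {E : IntervalExchange k} {y q z : Set.Ico (0 : ℝ) 1} {N : ℕ}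
    (h : E.Agree y z N) (hy : (y : ℝ) ≤ q) (hz : (q : ℝ) ≤ z) : E.Agree y q N := by
  induction N with
  | zero => exact fun s hs => absurd hs (by omega)
  | succ N ih =>
    have hN := ih (h.mono (by omega))
    intro s hs
    obtain hs | rfl : s < N ∨ s = N := by omega
    · exact hN s hs
    · have h1 := h.sub_eq (s := s) (by omega)
      have h2 := hN.sub_eq le_rfl
      symm
      rw [code_eq_iff]
      have h3 := E.code_mem ((E.T ^ s) y)
      have h4 := E.code_mem ((E.T ^ s) z)
      rw [← h s hs] at h4
      exact ⟨by linarith [h3.1], by linarith [h4.2]⟩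

/-- Where the codings of two points differ first, a left endpoint separates their images. -/
theorem exists_cut (E : IntervalExchange k) {y z : Set.Ico (0 : ℝ) 1} (hyz : (y : ℝ) ≤ z) {N : ℕ}
    (h : ¬ E.Agree y z N) :
    ∃ m < N, ∃ j : Fin k, (j : ℕ) ≠ 0 ∧ ∃ q : Set.Ico (0 : ℝ) 1, (y : ℝ) < q ∧ (q : ℝ) ≤ z ∧
      (E.T ^ m) q = E.leftPt j ∧ E.Agree y z m := by
  classical
  have hex : ∃ s, s < N ∧ E.code ((E.T ^ s) y) ≠ E.code ((E.T ^ s) z) := by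
    simpa [Agree] using h
  obtain ⟨hm, hne⟩ := Nat.find_spec hex
  set m := Nat.find hex
  have hagree : E.Agree y z m := by
    intro s hs
    by_contra hcon
    exact Nat.find_min hex hs ⟨by omega, hcon⟩
  have hsub := hagree.sub_eq le_rfl
  have hlt := E.lt_left_code (by linarith) hne
  have hle := E.left_code_le ((E.T ^ m) z)
  set j := E.code ((E.T ^ m) z)
  have hy0 := y.2.1
  have hz1 := z.2.2
  -- The left endpoint of the interval of `T^m z`, pulled back by the translation that `T^m`
  -- performs on all of `[y, z]`.
  let q : Set.Ico (0 : ℝ) 1 := ⟨y + (E.left j - ((E.T ^ m) y : Set.Ico (0 : ℝ) 1)),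
    by linarith, by linarith⟩
  have hyq : (y : ℝ) < q := by
    change (y : ℝ) < y + (E.left j - ((E.T ^ m) y : Set.Ico (0 : ℝ) 1))
    linarith
  have hqz : (q : ℝ) ≤ z := by
    change (y : ℝ) + (E.left j - ((E.T ^ m) y : Set.Ico (0 : ℝ) 1)) ≤ z
    linarith
  refine ⟨m, hm, j, ?_, q, hyq, hqz, ?_, hagree⟩
  · intro h0
    rw [E.left_of_val_eq_zero h0] at hlt
    linarith [((E.T ^ m) y).2.1]
  · apply Subtype.ext
    have h3 := (hagree.of_mem_Icc hyq.le hqz).sub_eq le_rfl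
    have h4 : (q : ℝ) = y + (E.left j - ((E.T ^ m) y : Set.Ico (0 : ℝ) 1)) := rfl
    change _ = E.left j
    linarith

/-- Points slightly to the right of `y` share a prescribed number of letters with `y`. -/
theorem exists_agree_right (E : IntervalExchange k) (y : Set.Ico (0 : ℝ) 1) (N : ℕ) :
    ∃ ε > 0, (y : ℝ) + ε ≤ 1 ∧
      ∀ z : Set.Ico (0 : ℝ) 1, (y : ℝ) ≤ z → (z : ℝ) < y + ε → E.Agree y z N := by
  induction N with
  | zero =>
    exact ⟨1 - y, by linarith [y.2.2], by linarith, fun z _ _ s hs => absurd hs (by omega)⟩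
  | succ N ih =>
    obtain ⟨ε, hε, h1, h⟩ := ih
    have hm := E.code_mem ((E.T ^ N) y)
    refine ⟨min ε (E.right (E.code ((E.T ^ N) y)) - ((E.T ^ N) y : Set.Ico (0 : ℝ) 1)),
      lt_min hε (sub_pos.2 hm.2), by linarith [min_le_left ε (E.right (E.code ((E.T ^ N) y)) -
        ((E.T ^ N) y : Set.Ico (0 : ℝ) 1))], fun z hz hz' s hs => ?_⟩
    have hz1 : (z : ℝ) - y < ε := lt_of_lt_of_le (by linarith) (min_le_left _ _)
    have hz2 := lt_of_lt_of_le (show (z : ℝ) - y < _ by linarith) (min_le_right _ _)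
    have ha := h z hz (by linarith)
    obtain hs | rfl : s < N ∨ s = N := by omega
    · exact ha s hs
    · symm
      rw [code_eq_iff]
      have h2 := ha.sub_eq le_rfl
      exact ⟨by linarith [hm.1], by linarith⟩

/-! ### Consequences of regularity -/

theorem T_leftPt (E : IntervalExchange k) (i : Fin k) :
    E.T (E.leftPt i) = E.inv.leftPt (E.perm.symm i) := by
  apply Subtype.ext
  rw [T_apply_coe, code_leftPt]
  change E.left i + (E.inv.left (E.perm.symm i) - E.left i) = E.inv.left (E.perm.symm i)
  ring

theorem inv_leftPt (E : IntervalExchange k) (i : Fin k) :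
    E.inv.leftPt i = E.T (E.leftPt (E.perm i)) := by
  rw [T_leftPt, Equiv.symm_apply_apply]

/-- The interval that the permutation places first lands at `0`. Thus `0` is itself the image of a
left endpoint, which lets regularity, stated only for nonzero indices, also reach index `0`. -/
theorem T_leftPt_perm_zero (E : IntervalExchange k) {o : Fin k} (ho : (o : ℕ) = 0) :
    E.T (E.leftPt (E.perm o)) = E.leftPt o := by
  rw [← inv_leftPt]
  apply Subtype.ext
  change E.inv.left o = E.left o
  rw [left_of_val_eq_zero _ ho, left_of_val_eq_zero _ ho]

theorem Regular.pow {E : IntervalExchange k} (hE : E.Regular) {i j : Fin k} (hi : (i : ℕ) ≠ 0)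
    (hj : (j : ℕ) ≠ 0) {n : ℕ} (h : (E.T ^ n) (E.leftPt i) = E.leftPt j) : n = 0 ∧ i = j := by
  obtain ⟨h1, h2⟩ := hE i j hi hj n (by simpa using h)
  exact ⟨by exact_mod_cast h1, h2⟩

/-- If the first interval stayed in place, the interval placed second would land exactly at the
second left endpoint, a forbidden connection of length `1`. -/
theorem Regular.perm_zero_ne {E : IntervalExchange k} (hE : E.Regular) (hk : 2 ≤ k) {o : Fin k}
    (ho : (o : ℕ) = 0) : (E.perm o : ℕ) ≠ 0 := by
  intro h
  have hfix : E.perm o = o := Fin.ext (h.trans ho.symm)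
  let a : Fin k := ⟨1, by omega⟩
  have hIio : Finset.Iio a = {o} := by
    ext l
    simp only [Finset.mem_Iio, Finset.mem_singleton, Fin.lt_def, Fin.ext_iff, a]
    omega
  have hne : (E.perm a : ℕ) ≠ 0 := by
    intro h0
    have : E.perm a = E.perm o := Fin.ext (h0.trans h.symm)
    have := congrArg Fin.val (E.perm.injective this)
    simp only [a] at this
    omega
  have hT : E.T (E.leftPt (E.perm a)) = E.leftPt a := by
    rw [← inv_leftPt]
    apply Subtype.ext
    change ∑ j ∈ Finset.Iio a, E.len (E.perm j) = ∑ j ∈ Finset.Iio a, E.len j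
    rw [hIio, Finset.sum_singleton, Finset.sum_singleton, hfix]
  have := (hE.pow (n := 1) hne (j := a) (by simp [a]) (by simpa using hT)).1
  omega

theorem Regular.T_pow_leftPt_ne {E : IntervalExchange k} (hE : E.Regular) {i j : Fin k}
    (hi : (i : ℕ) ≠ 0) {p : ℕ} (hp : p ≠ 0) : (E.T ^ p) (E.leftPt j) ≠ E.leftPt i := by
  intro h
  by_cases hj : (j : ℕ) = 0
  · have hk : 2 ≤ k := by have := i.2; omega
    rw [← E.T_leftPt_perm_zero hj, ← T_pow_succ_apply'] at h
    have := (hE.pow (hE.perm_zero_ne hk hj) hi h).1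
    omega
  · exact hp (hE.pow hj hi h).1

theorem Regular.T_pow_leftPt_ne_self {E : IntervalExchange k} (hE : E.Regular) (hk : 2 ≤ k)
    (j : Fin k) {p : ℕ} (hp : p ≠ 0) : (E.T ^ p) (E.leftPt j) ≠ E.leftPt j := by
  intro h
  by_cases hj : (j : ℕ) = 0
  · rw [← E.T_leftPt_perm_zero hj, ← T_pow_succ_apply', T_pow_succ_apply,
      E.T.injective.eq_iff] at h
    exact hp (hE.pow (hE.perm_zero_ne hk hj) (hE.perm_zero_ne hk hj) h).1
  · exact hp (hE.pow hj hj h).1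

/-- Left endpoints of the inverse exchange are images under `T` of original ones. When the original
one is `0`, a further step back reaches a nonzero index, hence the exponents `1` and `2` below. -/
theorem Regular.inv {E : IntervalExchange k} (hE : E.Regular) : E.inv.Regular := by
  intro i j hi hj n h
  have hk : 2 ≤ k := by have := i.2; omega
  let o : Fin k := ⟨0, by omega⟩
  have key : ∀ i : Fin k, (i : ℕ) ≠ 0 → (E.perm i : ℕ) = 0 →
      E.inv.leftPt i = (E.T ^ (2 : ℤ)) (E.leftPt (E.perm o)) := by
    intro i _ h0
    have h1 : E.perm i = o := Fin.ext h0
    rw [inv_leftPt, h1, ← E.T_leftPt_perm_zero (o := o) rfl]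
    rfl
  have key1 : ∀ i : Fin k, E.inv.leftPt i = (E.T ^ (1 : ℤ)) (E.leftPt (E.perm i)) := by
    intro i
    rw [inv_leftPt, zpow_one]
  have red : ∀ (a b : ℤ) (u v : Fin k), (u : ℕ) ≠ 0 → (v : ℕ) ≠ 0 →
      E.inv.leftPt i = (E.T ^ a) (E.leftPt u) → E.inv.leftPt j = (E.T ^ b) (E.leftPt v) →
      -b - n + a = 0 ∧ u = v := by
    intro a b u v hu hv h1 h2
    refine hE u v hu hv _ ?_
    rw [h1, h2, T_inv, inv_zpow', ← Equiv.Perm.mul_apply, ← zpow_add] at h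
    have h3 : (E.T ^ (-b)) ((E.T ^ (-n + a)) (E.leftPt u)) = E.leftPt v := by
      rw [h, ← Equiv.Perm.mul_apply, ← zpow_add]
      simp
    rw [← h3, ← Equiv.Perm.mul_apply, ← zpow_add]
    congr 2
    ring
  have hσ := hE.perm_zero_ne hk (o := o) rfl
  by_cases h1 : (E.perm i : ℕ) = 0 <;> by_cases h2 : (E.perm j : ℕ) = 0
  · have := (red 2 2 _ _ hσ hσ (key i hi h1) (key j hj h2)).1
    exact ⟨by omega, E.perm.injective (Fin.ext (h1.trans h2.symm))⟩
  · have := E.perm.injective (red 2 1 _ _ hσ h2 (key i hi h1) (key1 j)).2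
    exact absurd (congrArg Fin.val this).symm hj
  · have := E.perm.injective (red 1 2 _ _ h1 hσ (key1 i) (key j hj h2)).2
    exact absurd (congrArg Fin.val this) hi
  · obtain ⟨h3, h4⟩ := red 1 1 _ _ h1 h2 (key1 i) (key1 j)
    exact ⟨by omega, E.perm.injective h4⟩

/-- The largest cut point of order less than `N` not exceeding `y`. -/
theorem exists_greatest_cut (E : IntervalExchange k) (y : Set.Ico (0 : ℝ) 1) {N : ℕ}
    (hN : N ≠ 0) : ∃ (c : Set.Ico (0 : ℝ) 1) (q : ℕ) (j : Fin k), q < N ∧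
      (E.T ^ q) c = E.leftPt j ∧ (c : ℝ) ≤ y ∧ E.Agree c y N := by
  classical
  have hk : 0 < k := (Nat.zero_le _).trans_lt (E.code y).2
  let S : Finset (Fin N × Fin k) := Finset.univ.filter fun p =>
    ((E.inv.T ^ (p.1 : ℕ)) (E.leftPt p.2) : Set.Ico (0 : ℝ) 1) ≤ (y : ℝ)
  have hS : S.Nonempty := by
    refine ⟨(⟨0, Nat.pos_of_ne_zero hN⟩, ⟨0, hk⟩), ?_⟩
    simp only [S, Finset.mem_filter, Finset.mem_univ, true_and]
    change E.left _ ≤ (y : ℝ)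
    rw [E.left_of_val_eq_zero rfl]
    exact y.2.1
  obtain ⟨⟨q, j⟩, hp, hmax⟩ := S.exists_max_image
    (fun p => (((E.inv.T ^ (p.1 : ℕ)) (E.leftPt p.2) : Set.Ico (0 : ℝ) 1) : ℝ)) hS
  simp only [S, Finset.mem_filter, Finset.mem_univ, true_and] at hp hmax
  refine ⟨(E.inv.T ^ (q : ℕ)) (E.leftPt j), q, j, q.2, E.T_pow_T_inv_pow _ _, hp, ?_⟩
  -- A disagreement would produce a cut of order less than `N` in `]c, y]`, against maximality.
  by_contra hcon
  obtain ⟨m, hm, i, -, r, hr1, hr2, hr3, -⟩ := E.exists_cut hp hcon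
  have hr : r = (E.inv.T ^ m) (E.leftPt i) := by
    rw [← hr3, T_inv_pow_T_pow]
  have := hmax (⟨m, hm⟩, i) (by simpa only [← hr] using hr2)
  simp only [← hr] at this
  linarith

/-- The greatest cut below a point of period `p` undergoes the same translation under `T^p`, so it
is periodic too, and with it a left endpoint. -/
theorem Regular.T_pow_ne_self {E : IntervalExchange k} (hE : E.Regular) (hk : 2 ≤ k)
    (y : Set.Ico (0 : ℝ) 1) {p : ℕ} (hp : p ≠ 0) : (E.T ^ p) y ≠ y := by
  intro h
  obtain ⟨c, q, j, -, hc, -, hag⟩ := E.exists_greatest_cut y hp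
  have h1 := hag.sub_eq le_rfl
  rw [h] at h1
  have h2 : (E.T ^ p) c = c := Subtype.ext (by linarith)
  apply hE.T_pow_leftPt_ne_self hk j hp
  rw [← hc, ← T_pow_add_apply, add_comm, T_pow_add_apply, h2]

theorem Regular.T_pow_injective {E : IntervalExchange k} (hE : E.Regular) (hk : 2 ≤ k)
    (y : Set.Ico (0 : ℝ) 1) : Function.Injective fun n : ℕ => (E.T ^ n) y := by
  intro m n h
  wlog hmn : m < n generalizing m n
  · by_contra hne
    exact this h.symm (by omega) |>.symm |> hne
  obtain ⟨d, rfl⟩ := Nat.exists_eq_add_of_lt hmn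
  simp only [add_assoc, T_pow_add_apply] at h
  exact absurd ((E.T ^ m).injective h).symm (hE.T_pow_ne_self hk y (p := d + 1) (by omega))

end IntervalExchange
-- Gaps of a set transported along an orbit
open Filter Topology

/-- The set `A` does not meet `]z - g, z[`. -/
def FreeLeft (A : Set ℝ) (z g : ℝ) : Prop := ∀ v ∈ A, v < z → v ≤ z - g

theorem FreeLeft.mono {A : Set ℝ} {z g g' : ℝ} (h : FreeLeft A z g) (hg : g' ≤ g) :
    FreeLeft A z g' := fun v hv hz => (h v hv hz).trans (by linarith)

theorem Set.Finite.exists_freeLeft {D : Set ℝ} (hD : D.Finite) (z : ℝ) :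
    ∃ g > 0, FreeLeft D z g := by
  induction D, hD using Set.Finite.induction_on with
  | empty => exact ⟨1, one_pos, fun v hv => hv.elim⟩
  | @insert a D _ _ ih =>
    obtain ⟨g, hg, h⟩ := ih
    by_cases ha : a < z
    · refine ⟨min g (z - a), lt_min hg (by linarith), fun v hv hz => ?_⟩
      rcases hv with rfl | hv
      · linarith [min_le_right g (z - v)]
      · exact h.mono (min_le_left _ _) v hv hz
    · refine ⟨g, hg, fun v hv hz => ?_⟩
      rcases hv with rfl | hv
      · exact absurd hz ha
      · exact h v hv hz

/-- A bounded sequence of distinct points of `Ω` cannot carry gaps of `Ω` on its left which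
shrink only when meeting a fixed finite set. -/
theorem false_of_freeLeft_step {z : ℕ → ℝ} (hinj : Function.Injective z)
    (hb : ∀ n, z n ∈ Set.Icc (-1 : ℝ) 1) {D Ω : Set ℝ} (hD : D.Finite) (hΩ : ∀ n, z n ∈ Ω)
    (hstep : ∀ n g, 0 < g → FreeLeft Ω (z n) g → FreeLeft D (z n) g → FreeLeft Ω (z (n + 1)) g)
    {g₀ : ℝ} (hg₀ : 0 < g₀) (h₀ : FreeLeft Ω (z 0) g₀) : False := by
  have hgap : ∀ n, ∃ g > 0, FreeLeft Ω (z n) g := by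
    intro n
    induction n with
    | zero => exact ⟨g₀, hg₀, h₀⟩
    | succ n ih =>
      obtain ⟨g, hg, h⟩ := ih
      obtain ⟨g', hg', h'⟩ := hD.exists_freeLeft (z n)
      exact ⟨min g g', lt_min hg hg', hstep n _ (lt_min hg hg') (h.mono (min_le_left _ _))
        (h'.mono (min_le_right _ _))⟩
  -- Gaps to the left of distinct points of `Ω` are disjoint, so each `d` lies in the gap of at most
  -- one `z n`. From some `N` on, no gap meets the finite set `D`.
  have hsub : ∀ d, {n | ∃ g > 0, FreeLeft Ω (z n) g ∧ d < z n ∧ z n - g < d}.Subsingleton := by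
    rintro d n ⟨g, hg, hf, h1, h2⟩ m ⟨g', hg', hf', h1', h2'⟩
    apply hinj
    rcases lt_trichotomy (z n) (z m) with h | h | h
    · linarith [hf' (z n) (hΩ n) h]
    · exact h
    · linarith [hf (z m) (hΩ m) h]
  obtain ⟨N, hN⟩ : ∃ N, ∀ n ≥ N, ∀ g > 0, FreeLeft Ω (z n) g → FreeLeft D (z n) g := by
    have hfin := hD.biUnion (t := fun d => {n | ∃ g > 0, FreeLeft Ω (z n) g ∧ d < z n ∧ z n - g < d})
      fun d _ => (hsub d).finite
    obtain ⟨N, hN⟩ := hfin.bddAbove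
    refine ⟨N + 1, fun n hn g hg hf d hd hdz => ?_⟩
    by_contra hlt
    have : n ≤ N := hN (Set.mem_biUnion hd ⟨g, hg, hf, hdz, not_le.1 hlt⟩)
    omega
  obtain ⟨g, hg, hfN⟩ := hgap N
  have hall : ∀ n, FreeLeft Ω (z (N + n)) g := by
    intro n
    induction n with
    | zero => exact hfN
    | succ n ih => exact hstep _ g hg ih (hN _ (Nat.le_add_right N n) g hg ih)
  -- The points after time `N` are `g`-separated, so the floors of `z / g` are distinct, yet they
  -- lie in a bounded range.
  refine Set.infinite_of_injective_forall_mem (f := fun n => ⌊z (N + n) / g⌋) ?_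
    (s := Set.Icc ⌊-1 / g⌋ ⌊1 / g⌋) (fun n => ⟨?_, ?_⟩) (Set.finite_Icc _ _)
  · intro n m h
    have h1 := Int.abs_sub_lt_one_of_floor_eq_floor h
    rw [← sub_div, abs_div, abs_of_pos hg, div_lt_one hg, abs_lt] at h1
    have : N + n = N + m := by
      apply hinj
      rcases lt_trichotomy (z (N + n)) (z (N + m)) with h | h | h
      · linarith [hall m _ (hΩ (N + n)) h, h1.1]
      · exact h
      · linarith [hall n _ (hΩ (N + m)) h, h1.2]
    omega
  · exact Int.floor_le_floor (div_le_div_of_nonneg_right (hb _).1 hg.le)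
  · exact Int.floor_le_floor (div_le_div_of_nonneg_right (hb _).2 hg.le)

/-! ### Density of forward orbits -/

namespace IntervalExchange

variable {k : ℕ}

theorem left_code_lt (E : IntervalExchange k) {y : Set.Ico (0 : ℝ) 1}
    (hy : ∀ i, y ≠ E.leftPt i) : E.left (E.code y) < y :=
  lt_of_le_of_ne (E.left_code_le y) fun h => hy (E.code y) (Subtype.ext h.symm)

/-- A set stable under the inverse transformation has no gap next to a point of an orbit which
stays in the set and avoids the left endpoints. -/
theorem false_of_gap (E : IntervalExchange k) {Ω : Set ℝ}
    (hΩ : ∀ w : Set.Ico (0 : ℝ) 1, (w : ℝ) ∈ Ω → (∀ i, w ≠ E.inv.leftPt i) → (E.inv.T w : ℝ) ∈ Ω)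
    {z : Set.Ico (0 : ℝ) 1} (hz : ∀ (n : ℕ) i, (E.T ^ n) z ≠ E.leftPt i)
    (hinj : Function.Injective fun n : ℕ => (E.T ^ n) z)
    (hzΩ : ∀ n : ℕ, ((E.T ^ n) z : ℝ) ∈ Ω) {g : ℝ} (hg : 0 < g)
    (hgap : FreeLeft Ω z g ∨ FreeLeft (Neg.neg ⁻¹' Ω) (-z) g) : False := by
  -- Within the interior of one interval of the partition, points of `Ω` pull back to points of `Ω`.
  -- A gap therefore moves forward intact unless it contains an end of that interval.
  have hpull : ∀ (y w : Set.Ico (0 : ℝ) 1), E.left (E.code y) < w →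
      (w : ℝ) < E.right (E.code y) → (w : ℝ) + E.shift (E.code y) ∈ Ω → (w : ℝ) ∈ Ω := by
    intro y w h1 h2 h3
    have hc : E.code w = E.code y := (E.code_eq_iff _ _).2 ⟨h1.le, h2⟩
    rw [← hc] at h3 h1
    have h4 := hΩ (E.T w) h3 fun i hi => by
      rw [inv_leftPt, E.T.injective.eq_iff] at hi
      rw [hi, code_leftPt] at h1
      exact lt_irrefl _ h1
    rwa [show E.inv.T (E.T w) = w from E.T_inv_pow_T_pow 1 w] at h4
  rcases hgap with hgap | hgap
  · refine false_of_freeLeft_step (z := fun n => (((E.T ^ n) z : Set.Ico (0 : ℝ) 1) : ℝ))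
      (fun m n h => hinj (Subtype.ext h))
      (fun n => ⟨by linarith [((E.T ^ n) z).2.1], ((E.T ^ n) z).2.2.le⟩)
      (Set.finite_range E.left) hzΩ ?_ hg hgap
    intro n g hg hf hD v hv hvz
    simp only [T_pow_succ_apply, T_apply_coe] at hvz ⊢
    by_contra hlt
    set y := (E.T ^ n) z
    have h1 := hD _ ⟨E.code y, rfl⟩ (E.left_code_lt (hz n))
    have h2 := (E.code_mem y).2
    have h0 := E.left_nonneg (E.code y)
    let w : Set.Ico (0 : ℝ) 1 := ⟨v - E.shift (E.code y), by linarith, by linarith [y.2.2]⟩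
    have hw : (w : ℝ) = v - E.shift (E.code y) := rfl
    have := hf w (hpull y w (by linarith) (by linarith) (by rwa [hw, sub_add_cancel]))
      (by linarith)
    linarith
  -- A gap on the right becomes a gap on the left after reflection. The obstructions are then the
  -- right endpoints.
  · refine false_of_freeLeft_step (z := fun n => -(((E.T ^ n) z : Set.Ico (0 : ℝ) 1) : ℝ))
      (fun m n h => hinj (Subtype.ext (neg_injective h)))
      (fun n => ⟨by linarith [((E.T ^ n) z).2.2], by linarith [((E.T ^ n) z).2.1]⟩)
      (Ω := Neg.neg ⁻¹' Ω) (Set.finite_range fun i => -E.right i) (by simpa using hzΩ) ?_ hg hgap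
    intro n g hg hf hD v hv hvz
    simp only [T_pow_succ_apply, T_apply_coe] at hvz ⊢
    by_contra hlt
    set y := (E.T ^ n) z
    have h2 := hD _ ⟨E.code y, rfl⟩ (neg_lt_neg (E.code_mem y).2)
    have h1 := E.left_code_lt (hz n)
    have h0 := E.right_le_one (E.code y)
    let w : Set.Ico (0 : ℝ) 1 := ⟨-v - E.shift (E.code y), by linarith [y.2.1], by linarith⟩
    have hw : (w : ℝ) = -v - E.shift (E.code y) := rfl
    have := hf (-w) (by
      have := hpull y w (by linarith) (by linarith) (by rw [hw, sub_add_cancel]; exact hv)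
      simpa using this) (by linarith)
    linarith

/-- Near `t` the map is a single translation on the points of `[0,1[`. Only those points matter, so
the statement also serves at `t = 0` and at `t = 1`. -/
theorem mapClusterPt_add_shift (E : IntervalExchange k) {u : ℕ → Set.Ico (0 : ℝ) 1} {t : ℝ}
    (ht : MapClusterPt t atTop fun n => (u n : ℝ)) {i : Fin k}
    (hi : ∀ᶠ y in 𝓝 t, y ∈ Set.Ico (0 : ℝ) 1 → y ∈ E.X i) :
    MapClusterPt (t + E.shift i) atTop fun n => (E.T (u n) : ℝ) := by
  rw [mapClusterPt_iff_frequently] at ht ⊢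
  intro s hs
  have h1 : ∀ᶠ y in 𝓝 t, y + E.shift i ∈ s :=
    (continuous_add_const (E.shift i)).continuousAt.eventually hs
  refine (ht _ (hi.and h1)).mono fun n hn => ?_
  rw [T_apply_coe, (E.code_eq_iff _ _).2 (hn.1 (u n).2)]
  exact hn.2

theorem mapClusterPt_T (E : IntervalExchange k) {u : ℕ → Set.Ico (0 : ℝ) 1}
    {v : Set.Ico (0 : ℝ) 1} (hv : MapClusterPt (v : ℝ) atTop fun n => (u n : ℝ))
    (h : ∀ i, v ≠ E.leftPt i) : MapClusterPt (E.T v : ℝ) atTop fun n => (E.T (u n) : ℝ) := by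
  refine E.mapClusterPt_add_shift hv ?_
  filter_upwards [Ioo_mem_nhds (E.left_code_lt h) (E.code_mem v).2] with y hy _
  exact ⟨hy.1.le, hy.2⟩

theorem mapClusterPt_succ {u : ℕ → ℝ} {t : ℝ} :
    MapClusterPt t atTop (fun n => u (n + 1)) ↔ MapClusterPt t atTop u := by
  unfold MapClusterPt
  rw [show (fun n => u (n + 1)) = u ∘ fun n => n + 1 from rfl, ← Filter.map_map,
    Filter.map_add_atTop_eq_nat]

theorem shift_eq (E : IntervalExchange k) (i : Fin k) :
    E.shift i = E.inv.left (E.perm.symm i) - E.left i := rfl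

theorem right_last (E : IntervalExchange k) {l : Fin k} (hl : (l : ℕ) + 1 = k) :
    E.right l = 1 := by
  rw [← E.sum_len, right]
  congr 1
  ext j
  simp only [Finset.mem_Iic, Finset.mem_univ, iff_true, Fin.le_def]
  have := j.2
  omega

/-- Compactness gives a cluster point in `[0,1]`. If it is `0` or `1`, the translation of the first
or last interval carries it inside. Otherwise that interval would not move and its left endpoint
would be fixed. -/
theorem Regular.exists_mapClusterPt_mem_Ioo {E : IntervalExchange k} (hE : E.Regular) (hk : 2 ≤ k)
    (x : Set.Ico (0 : ℝ) 1) :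
    ∃ t ∈ Set.Ioo (0 : ℝ) 1, MapClusterPt t atTop fun n : ℕ => ((E.T ^ n) x : ℝ) := by
  obtain ⟨t, ht, hc⟩ := (isCompact_Icc (a := (0 : ℝ)) (b := 1)).exists_mapClusterPt
    (u := fun n : ℕ => ((E.T ^ n) x : ℝ)) (f := atTop)
    (Filter.tendsto_principal.2 <| Filter.Eventually.of_forall fun n =>
      ⟨((E.T ^ n) x).2.1, ((E.T ^ n) x).2.2.le⟩)
  have hmove : ∀ i, (∀ᶠ y in 𝓝 t, y ∈ Set.Ico (0 : ℝ) 1 → y ∈ E.X i) →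
      MapClusterPt (t + E.shift i) atTop fun n : ℕ => ((E.T ^ n) x : ℝ) := by
    intro i hi
    have := E.mapClusterPt_add_shift hc hi
    simp only [← T_pow_succ_apply] at this
    exact mapClusterPt_succ.1 this
  by_cases h0 : t = 0
  · let o : Fin k := ⟨0, by omega⟩
    have ho : E.left o = 0 := E.left_of_val_eq_zero rfl
    have hr := E.right_eq o
    have hp := E.len_pos o
    refine ⟨t + E.shift o, ?_, hmove o ?_⟩
    · have h1 := E.inv.left_nonneg (E.perm.symm o)
      have h2 := E.inv.left_lt_one (E.perm.symm o)
      rw [h0, shift_eq, ho]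
      refine ⟨lt_of_le_of_ne (by linarith) fun h => ?_, by linarith⟩
      apply hE.T_pow_leftPt_ne_self hk o one_ne_zero
      rw [pow_one, T_leftPt]
      apply Subtype.ext
      change E.inv.left (E.perm.symm o) = E.left o
      linarith
    · filter_upwards [Iio_mem_nhds (show t < E.right o by linarith)] with y hy hy'
      exact ⟨by rw [ho]; exact hy'.1, hy⟩
  by_cases h1 : t = 1
  · let l : Fin k := ⟨k - 1, by omega⟩
    have hl : (l : ℕ) + 1 = k := by simp only [l]; omega
    have hr := E.right_last hl
    have hr' := E.right_eq l
    have hp := E.len_pos l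
    refine ⟨t + E.shift l, ?_, hmove l ?_⟩
    · have h3 := E.inv.left_nonneg (E.perm.symm l)
      rw [h1, shift_eq]
      refine ⟨by linarith, ?_⟩
      have h4 := E.inv.right_eq (E.perm.symm l)
      have h5 : E.inv.len (E.perm.symm l) = E.len l := by simp [IntervalExchange.inv]
      rcases lt_or_eq_of_le (show E.perm.symm l ≤ l by
        rw [Fin.le_def]; have := (E.perm.symm l).2; omega) with h | h
      · linarith [E.inv.right_le_left h, E.inv.left_lt_one l]
      · exfalso
        apply hE.T_pow_leftPt_ne_self hk l one_ne_zero
        rw [pow_one, T_leftPt]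
        apply Subtype.ext
        change E.inv.left (E.perm.symm l) = E.left l
        have h6 := E.inv.right_last hl
        rw [h] at h4 h5 ⊢
        linarith
    · filter_upwards [Ioi_mem_nhds (show E.left l < t by linarith)] with y hy hy'
      exact ⟨le_of_lt hy, by rw [hr]; exact hy'.2⟩
  · exact ⟨t, ⟨lt_of_le_of_ne ht.1 (Ne.symm h0), lt_of_le_of_ne ht.2 h1⟩, hc⟩

/-- If both half-orbits met endpoints, joining them would give a positive iterate of `T` from a left
endpoint to a nonzero one. The assumption `z ≠ 0` excludes hitting index `0` at time `0`; a later
hit of `0` is preceded by a nonzero endpoint. -/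
theorem Regular.avoids_leftPt {E : IntervalExchange k} (hE : E.Regular) (hk : 2 ≤ k)
    {z : Set.Ico (0 : ℝ) 1} (hz : (z : ℝ) ≠ 0) :
    (∀ (n : ℕ) i, (E.T ^ n) z ≠ E.leftPt i) ∨ ∀ (n : ℕ) i, (E.inv.T ^ n) z ≠ E.inv.leftPt i := by
  by_contra! hcon
  obtain ⟨⟨p, i, hp⟩, q, j, hq⟩ := hcon
  have hhit : ∃ (p : ℕ) (i : Fin k), (i : ℕ) ≠ 0 ∧ (E.T ^ p) z = E.leftPt i := by
    by_cases hi : (i : ℕ) = 0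
    · obtain _ | p := p
      · exact absurd (congrArg Subtype.val hp) (by
          change (z : ℝ) ≠ E.left i
          rwa [E.left_of_val_eq_zero hi])
      · refine ⟨p, _, hE.perm_zero_ne hk hi, E.T.injective ?_⟩
        rw [E.T_leftPt_perm_zero hi, ← T_pow_succ_apply, hp]
    · exact ⟨p, i, hi, hp⟩
  obtain ⟨p, i, hi, hp⟩ := hhit
  have hz' : z = (E.T ^ (q + 1)) (E.leftPt (E.perm j)) := by
    rw [T_pow_succ_apply', ← inv_leftPt, ← hq, T_pow_T_inv_pow]
  rw [hz', ← T_pow_add_apply] at hp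
  exact hE.T_pow_leftPt_ne hi (by omega) hp

/-- Every forward orbit of a regular interval exchange of at least two intervals is dense. -/
theorem Regular.exists_T_pow_mem_Ioo {E : IntervalExchange k} (hE : E.Regular) (hk : 2 ≤ k)
    (x : Set.Ico (0 : ℝ) 1) {c d : ℝ} (hc : 0 ≤ c) (hcd : c < d) (hd : d ≤ 1) :
    ∃ n : ℕ, ((E.T ^ n) x : ℝ) ∈ Set.Ioo c d := by
  by_contra! hcon
  set Ω : Set ℝ := {t | MapClusterPt t atTop fun n : ℕ => ((E.T ^ n) x : ℝ)} with hΩdef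
  have hclosed : IsClosed Ω := isClosed_setOfPred_clusterPt
  have hgapΩ : ∀ t ∈ Ω, t ≤ c ∨ d ≤ t := by
    intro t ht
    by_contra! h
    obtain ⟨n, hn⟩ := (mapClusterPt_iff_frequently.1 ht _ (Ioo_mem_nhds h.1 h.2)).exists
    exact hcon n hn
  have hfwd : ∀ v : Set.Ico (0 : ℝ) 1, (v : ℝ) ∈ Ω → (∀ i, v ≠ E.leftPt i) → (E.T v : ℝ) ∈ Ω := by
    intro v hv h
    have := E.mapClusterPt_T hv h
    simp only [← T_pow_succ_apply] at this
    exact mapClusterPt_succ.1 this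
  have hbwd : ∀ v : Set.Ico (0 : ℝ) 1, (v : ℝ) ∈ Ω → (∀ i, v ≠ E.inv.leftPt i) →
      (E.inv.T v : ℝ) ∈ Ω := by
    intro v hv h
    have := E.inv.mapClusterPt_T (u := fun n => (E.T ^ (n + 1)) x) (mapClusterPt_succ.2 hv) h
    have h2 : ∀ n : ℕ, E.inv.T ((E.T ^ (n + 1)) x) = (E.T ^ n) x := fun n => by
      rw [T_pow_succ_apply]
      exact E.T_inv_pow_T_pow 1 _
    simp only [h2] at this
    exact this
  have horbit : ∀ (E' : IntervalExchange k), (∀ v : Set.Ico (0 : ℝ) 1, (v : ℝ) ∈ Ω →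
      (∀ i, v ≠ E'.leftPt i) → (E'.T v : ℝ) ∈ Ω) → ∀ z : Set.Ico (0 : ℝ) 1, (z : ℝ) ∈ Ω →
      (∀ (n : ℕ) i, (E'.T ^ n) z ≠ E'.leftPt i) → ∀ n : ℕ, ((E'.T ^ n) z : ℝ) ∈ Ω := by
    intro E' h z hz hav n
    induction n with
    | zero => exact hz
    | succ n ih =>
      rw [T_pow_succ_apply]
      exact h _ ih (hav n)
  -- The point of `Ω` nearest to the missed interval, on the side where an interior cluster point
  -- exists.
  obtain ⟨z, hz, hz0, hgap⟩ : ∃ z : Set.Ico (0 : ℝ) 1, (z : ℝ) ∈ Ω ∧ (z : ℝ) ≠ 0 ∧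
      (FreeLeft Ω z (d - c) ∨ FreeLeft (Neg.neg ⁻¹' Ω) (-z) (d - c)) := by
    obtain ⟨t, ht, htΩ⟩ := hE.exists_mapClusterPt_mem_Ioo hk x
    rcases hgapΩ t htΩ with htc | htd
    · have hne : (Ω ∩ Set.Iic c).Nonempty := ⟨t, htΩ, htc⟩
      have hbdd : BddAbove (Ω ∩ Set.Iic c) := ⟨c, fun v hv => hv.2⟩
      have hmem := (hclosed.inter isClosed_Iic).csSup_mem hne hbdd
      have hle := le_csSup hbdd (show t ∈ Ω ∩ Set.Iic c from ⟨htΩ, htc⟩)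
      have hsc : sSup (Ω ∩ Set.Iic c) ≤ c := hmem.2
      refine ⟨⟨sSup (Ω ∩ Set.Iic c), by linarith [ht.1], by linarith⟩, hmem.1,
        (ht.1.trans_le hle).ne', Or.inr fun v hv hvz => ?_⟩
      rcases hgapΩ _ hv with h | h
      · have := le_csSup hbdd (show -v ∈ Ω ∩ Set.Iic c from ⟨hv, h⟩)
        simp only at hvz
        linarith
      · simp only
        linarith
    · have hne : (Ω ∩ Set.Ici d).Nonempty := ⟨t, htΩ, htd⟩
      have hbdd : BddBelow (Ω ∩ Set.Ici d) := ⟨d, fun v hv => hv.2⟩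
      have hmem := (hclosed.inter isClosed_Ici).csInf_mem hne hbdd
      have hle := csInf_le hbdd (show t ∈ Ω ∩ Set.Ici d from ⟨htΩ, htd⟩)
      have hsc : d ≤ sInf (Ω ∩ Set.Ici d) := hmem.2
      refine ⟨⟨sInf (Ω ∩ Set.Ici d), by linarith, by linarith [ht.2]⟩, hmem.1,
        ((hc.trans_lt hcd).trans_le hsc).ne', Or.inl fun v hv hvz => ?_⟩
      rcases hgapΩ _ hv with h | h
      · simp only
        linarith
      · have := csInf_le hbdd (show v ∈ Ω ∩ Set.Ici d from ⟨hv, h⟩)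
        simp only at hvz
        linarith
  rcases hE.avoids_leftPt hk hz0 with hav | hav
  · exact E.false_of_gap hbwd hav (hE.T_pow_injective hk z) (horbit E hfwd z hz hav)
      (sub_pos.2 hcd) hgap
  · refine E.inv.false_of_gap ?_ hav (hE.inv.T_pow_injective hk z) (horbit E.inv hbwd z hz hav)
      (sub_pos.2 hcd) hgap
    rw [E.inv_inv]
    exact hfwd

end IntervalExchange

/-! ### Words over at most one letter -/

namespace InfiniteWord

variable {A : Type*}

theorem block_eq_block_iff {U V : ℕ → A} {i j n : ℕ} :
    block U i n = block V j n ↔ ∀ s < n, U (i + s) = V (j + s) := by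
  unfold block
  rw [List.ofFn_inj, funext_iff]
  exact ⟨fun h s hs => h ⟨s, hs⟩, fun h s => h s s.2⟩

theorem length_block (U : ℕ → A) (i n : ℕ) : (block U i n).length = n := by
  simp [block]

theorem propertyR_one [Subsingleton A] (U : ℕ → A) : PropertyR 1 U := by
  have hpos : ∀ w, positions U w = Set.univ := fun w => by
    refine Set.eq_univ_of_forall fun i => ?_
    exact List.ext_getElem (length_block _ _ _) fun _ _ _ => Subsingleton.elim _ _
  refine ⟨fun w _ => by rw [hpos]; exact Set.infinite_univ, fun w _ => ?_⟩
  have : returnWords U w = {block U 0 1} := by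
    ext v
    simp only [returnWords, hpos, Set.mem_univ, true_and, Set.mem_singleton_iff, not_true,
      imp_false, not_lt, Set.mem_ofPred_eq]
    constructor
    · rintro ⟨i, j, hij, h, rfl⟩
      have : j - i = 1 := by have := h (i + 1) (by omega); omega
      rw [this]
      exact block_eq_block_iff.2 fun _ _ => Subsingleton.elim _ _
    · rintro rfl
      exact ⟨0, 1, one_pos, fun l hl => hl, rfl⟩
  rw [this, Set.encard_singleton]
  rfl

end InfiniteWord

/-! ### Cylinders and return words -/

namespace IntervalExchange

open InfiniteWord

variable {k : ℕ}

theorem word_T_pow (E : IntervalExchange k) (x : Set.Ico (0 : ℝ) 1) (m n : ℕ) :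
    E.word ((E.T ^ m) x) n = E.word x (m + n) := by
  unfold word
  rw [← T_pow_add_apply, add_comm]

/-- The points whose coding begins with `w`. -/
def cylinder (E : IntervalExchange k) (w : List (Fin k)) : Set (Set.Ico (0 : ℝ) 1) :=
  {y | block (E.word y) 0 w.length = w}

theorem block_word_T_pow (E : IntervalExchange k) (x : Set.Ico (0 : ℝ) 1) (i n : ℕ) :
    block (E.word ((E.T ^ i) x)) 0 n = block (E.word x) i n :=
  block_eq_block_iff.2 fun s _ => by rw [word_T_pow, zero_add]

theorem mem_positions_word (E : IntervalExchange k) (x : Set.Ico (0 : ℝ) 1) (w : List (Fin k))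
    (i : ℕ) : i ∈ positions (E.word x) w ↔ (E.T ^ i) x ∈ E.cylinder w := by
  change block (E.word x) i w.length = w ↔ block (E.word ((E.T ^ i) x)) 0 w.length = w
  rw [block_word_T_pow]

theorem agree_iff_block_eq {E : IntervalExchange k} {y z : Set.Ico (0 : ℝ) 1} {n : ℕ} :
    E.Agree y z n ↔ block (E.word y) 0 n = block (E.word z) 0 n := by
  rw [block_eq_block_iff]
  simp only [zero_add]
  rfl

section Cylinder

variable {E : IntervalExchange k} {w : List (Fin k)} {y z : Set.Ico (0 : ℝ) 1}

theorem Agree.mem_cylinder (h : E.Agree y z w.length) (hy : y ∈ E.cylinder w) :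
    z ∈ E.cylinder w :=
  (agree_iff_block_eq.1 h).symm.trans hy

theorem agree_of_mem_cylinder (hy : y ∈ E.cylinder w) (hz : z ∈ E.cylinder w) :
    E.Agree y z w.length :=
  agree_iff_block_eq.2 (Eq.trans hy (Eq.symm hz))

/-- A nonempty cylinder has a least element, which is a cut point or `0`. -/
theorem exists_least_cylinder (hy : y ∈ E.cylinder w) :
    ∃ c ∈ E.cylinder w, (∀ z ∈ E.cylinder w, (c : ℝ) ≤ z) ∧
      ∃ (q : ℕ) (j : Fin k), q ≤ w.length ∧ (q < w.length ∨ (j : ℕ) = 0) ∧ (E.T ^ q) c = E.leftPt j := by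
  have hk : 0 < k := (Nat.zero_le _).trans_lt (E.code y).2
  -- The empty word admits no cut of order less than `0`. Its cylinder is all of `[0,1[`, with least
  -- point `0`.
  by_cases hw : w.length = 0
  · refine ⟨E.leftPt ⟨0, hk⟩, Agree.mem_cylinder (fun s hs => absurd hs (by omega)) hy,
      fun z _ => ?_, 0, ⟨0, hk⟩, by omega, Or.inr rfl, rfl⟩
    change E.left _ ≤ (z : ℝ)
    rw [E.left_of_val_eq_zero rfl]
    exact z.2.1
  · obtain ⟨c, q, j, hq, hc, -, hag⟩ := E.exists_greatest_cut y hw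
    have hcw := hag.symm.mem_cylinder hy
    refine ⟨c, hcw, fun z hz => ?_, q, j, hq.le, Or.inl hq, hc⟩
    by_contra hlt
    have h := agree_of_mem_cylinder hz hcw
    have h1 := h.sub_eq hq.le
    have h2 := E.left_code_le ((E.T ^ q) z)
    rw [h q hq, hc, code_leftPt] at h2
    rw [hc] at h1
    change E.left j - _ = _ at h1
    linarith

/-- The first return time to the cylinder of `w`. -/
noncomputable def returnTime (E : IntervalExchange k) (w : List (Fin k))
    (y : Set.Ico (0 : ℝ) 1) : ℕ := sInf {r | 0 < r ∧ (E.T ^ r) y ∈ E.cylinder w}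

/-- The coding of `y` until its first return to the cylinder of `w`. -/
noncomputable def returnWord (E : IntervalExchange k) (w : List (Fin k))
    (y : Set.Ico (0 : ℝ) 1) : List (Fin k) := block (E.word y) 0 (E.returnTime w y)

theorem returnTime_le {r : ℕ} (hr : 0 < r) (h : (E.T ^ r) y ∈ E.cylinder w) :
    E.returnTime w y ≤ r := Nat.sInf_le ⟨hr, h⟩

theorem returnTime_spec (hret : ∃ r, 0 < r ∧ (E.T ^ r) y ∈ E.cylinder w) :
    0 < E.returnTime w y ∧ (E.T ^ E.returnTime w y) y ∈ E.cylinder w := Nat.sInf_mem hret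

theorem returnWords_word (hret : ∀ y, ∃ r, 0 < r ∧ (E.T ^ r) y ∈ E.cylinder w)
    (x : Set.Ico (0 : ℝ) 1) : returnWords (E.word x) w =
      {v | ∃ i, (E.T ^ i) x ∈ E.cylinder w ∧ v = E.returnWord w ((E.T ^ i) x)} := by
  ext v
  simp only [returnWords, mem_positions_word, Set.mem_ofPred_eq]
  constructor
  · rintro ⟨i, hi, j, hj, hij, hl, rfl⟩
    refine ⟨i, hi, ?_⟩
    obtain ⟨h1, h2⟩ := returnTime_spec (hret ((E.T ^ i) x))
    have h3 : E.returnTime w ((E.T ^ i) x) = j - i := by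
      apply le_antisymm
      · refine returnTime_le (by omega) ?_
        rwa [← T_pow_add_apply, Nat.sub_add_cancel hij.le]
      · by_contra hlt
        rw [← T_pow_add_apply] at h2
        exact hl _ (by omega) (by omega) h2
    rw [returnWord, h3, block_word_T_pow]
  · rintro ⟨i, hi, rfl⟩
    obtain ⟨h1, h2⟩ := returnTime_spec (hret ((E.T ^ i) x))
    rw [← T_pow_add_apply] at h2
    refine ⟨i, hi, _, h2, by omega, fun l hil hl hmem => ?_, ?_⟩
    · have := returnTime_le (y := (E.T ^ i) x) (r := l - i) (w := w) (E := E) (by omega) (by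
        rwa [← T_pow_add_apply, Nat.sub_add_cancel hil.le])
      omega
    · rw [returnWord, Nat.add_sub_cancel, block_word_T_pow]

/-! ### Cuts of a cylinder into pieces with constant return word -/

/-- The first time, from the length of `w` on, at which the backward orbit of the `i`-th left
endpoint is in the cylinder of `w`. -/
noncomputable def cutTime (E : IntervalExchange k) (w : List (Fin k)) (i : Fin k) : ℕ :=
  sInf {m | w.length ≤ m ∧ (E.inv.T ^ m) (E.leftPt i) ∈ E.cylinder w}

/-- The point of the cylinder of `w` reached at the time `cutTime`. -/
noncomputable def cutPt (E : IntervalExchange k) (w : List (Fin k)) (i : Fin k) :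
    Set.Ico (0 : ℝ) 1 := (E.inv.T ^ E.cutTime w i) (E.leftPt i)

theorem T_pow_cutPt (E : IntervalExchange k) (w : List (Fin k)) (i : Fin k) :
    (E.T ^ E.cutTime w i) (E.cutPt w i) = E.leftPt i := E.T_pow_T_inv_pow _ _

theorem cutTime_le {i : Fin k} {m : ℕ} (hm : w.length ≤ m) (hy : y ∈ E.cylinder w)
    (h : (E.T ^ m) y = E.leftPt i) : E.cutTime w i ≤ m :=
  Nat.sInf_le ⟨hm, by rwa [← h, T_inv_pow_T_pow]⟩

theorem cutTime_spec {i : Fin k}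
    (h : ∃ m, w.length ≤ m ∧ (E.inv.T ^ m) (E.leftPt i) ∈ E.cylinder w) :
    w.length ≤ E.cutTime w i ∧ E.cutPt w i ∈ E.cylinder w := Nat.sInf_mem h

/-- A separation of the codings before time `|w| + r`, with `r` the smaller return time, comes from
a preimage `q` of a left endpoint. Either `q` is the cut point, which is excluded, or its orbit
passes through the cut point later and brings `y` back to the cylinder before time `r`. -/
theorem returnWord_eq_of_le (hret : ∀ y, ∃ r, 0 < r ∧ (E.T ^ r) y ∈ E.cylinder w)
    (hcut : ∀ i : Fin k, ∃ m, w.length ≤ m ∧ (E.inv.T ^ m) (E.leftPt i) ∈ E.cylinder w)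
    (hy : y ∈ E.cylinder w) (hz : z ∈ E.cylinder w) (hyz : (y : ℝ) ≤ z)
    (hno : ∀ j : Fin k, (j : ℕ) ≠ 0 → (y : ℝ) < E.cutPt w j → ¬ (E.cutPt w j : ℝ) ≤ z) :
    E.returnWord w y = E.returnWord w z := by
  obtain ⟨hy1, hy2⟩ := returnTime_spec (hret y)
  obtain ⟨hz1, hz2⟩ := returnTime_spec (hret z)
  set r := min (E.returnTime w y) (E.returnTime w z) with hr
  have hag : E.Agree y z (w.length + r) := by
    by_contra hcon
    obtain ⟨m, hm, j, hj, q, hyq, hqz, hq, hag⟩ := E.exists_cut hyz hcon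
    have hyq' := hag.of_mem_Icc hyq.le hqz
    -- Before time `|w|` the codings agree, so no left endpoint can separate the images.
    have hnm : w.length ≤ m := by
      by_contra hlt
      have h0 := agree_of_mem_cylinder hy hz
      have h2 := h0.of_mem_Icc hyq.le hqz m (by omega)
      rw [hq, code_leftPt] at h2
      have h3 := E.left_code_le ((E.T ^ m) y)
      have h4 := hyq'.sub_eq le_rfl
      rw [h2] at h3
      rw [hq] at h4
      change E.left j - _ = _ at h4
      linarith
    have hqw := (hyq'.mono hnm).mem_cylinder hy
    have hle := cutTime_le hnm hqw hq
    obtain ⟨hc1, hc2⟩ := cutTime_spec (hcut j)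
    have hlt : E.cutTime w j < m := by
      refine lt_of_le_of_ne hle fun h => ?_
      have h1 : E.cutPt w j = q := by
        rw [cutPt, h, ← hq, T_inv_pow_T_pow]
      exact hno j hj (by rwa [h1]) (by rwa [h1])
    have hs : (E.T ^ (m - E.cutTime w j)) q = E.cutPt w j := by
      apply (E.T ^ E.cutTime w j).injective
      rw [T_pow_cutPt, ← T_pow_add_apply, Nat.add_sub_cancel' hle, hq]
    have hys : (E.T ^ (m - E.cutTime w j)) y ∈ E.cylinder w := by
      refine (hyq'.shift ?_).symm.mem_cylinder (by rwa [hs])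
      omega
    have := returnTime_le (by omega) hys
    omega
  have hag' : E.Agree ((E.T ^ r) y) ((E.T ^ r) z) w.length := hag.shift le_rfl
  have hyr : (E.T ^ r) y ∈ E.cylinder w := by
    rcases min_choice (E.returnTime w y) (E.returnTime w z) with h | h
    · rwa [hr, h]
    · refine hag'.symm.mem_cylinder ?_
      rwa [hr, h]
  have hzr := hag'.mem_cylinder hyr
  have h0 : 0 < r := lt_min hy1 hz1
  have h1 : E.returnTime w y = r := le_antisymm (returnTime_le h0 hyr) (min_le_left _ _)
  have h2 : E.returnTime w z = r := le_antisymm (returnTime_le h0 hzr) (min_le_right _ _)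
  rw [returnWord, returnWord, h1, h2]
  exact agree_iff_block_eq.1 (hag.mono (by omega))

/-- Equal return words would give agreement on `|w| + r` letters, shared by the cut between the two
points. If the cut reaches its left endpoint within that time, the agreement breaks there. Otherwise
its return at time `r` gives an earlier entry time, still at least `|w|`, against minimality. -/
theorem returnWord_ne_of_cutPt (hret : ∀ y, ∃ r, 0 < r ∧ (E.T ^ r) y ∈ E.cylinder w)
    {j : Fin k} (hyj : (y : ℝ) < E.cutPt w j) (hjz : (E.cutPt w j : ℝ) ≤ z) :
    E.returnWord w y ≠ E.returnWord w z := by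
  intro heq
  obtain ⟨hy1, hy2⟩ := returnTime_spec (hret y)
  obtain ⟨-, hz2⟩ := returnTime_spec (hret z)
  have hr : E.returnTime w z = E.returnTime w y := by
    have := congrArg List.length heq
    simpa only [returnWord, length_block] using this.symm
  rw [returnWord, returnWord, hr] at heq
  rw [hr] at hz2
  set r := E.returnTime w y
  have hag : E.Agree y z (w.length + r) := by
    intro s hs
    by_cases hsr : s < r
    · exact agree_iff_block_eq.2 heq s hsr
    · have := agree_of_mem_cylinder hy2 hz2 (s - r) (by omega)
      rwa [← T_pow_add_apply, ← T_pow_add_apply, Nat.sub_add_cancel (by omega)] at this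
  have hag' := hag.of_mem_Icc hyj.le hjz
  have hrw : (E.T ^ r) (E.cutPt w j) ∈ E.cylinder w :=
    (hag'.shift (s := r) le_rfl).mem_cylinder hy2
  have hT := E.T_pow_cutPt w j
  rcases lt_or_ge (E.cutTime w j) (w.length + r) with hlt | hge
  · have h1 := hag'.sub_eq hlt.le
    have h2 := E.left_code_le ((E.T ^ E.cutTime w j) y)
    rw [hag' _ hlt, hT, code_leftPt] at h2
    rw [hT] at h1
    change E.left j - _ = _ at h1
    linarith
  · have := cutTime_le (i := j) (m := E.cutTime w j - r) (by omega) hrw (by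
      rw [← T_pow_add_apply, Nat.sub_add_cancel (by omega), hT])
    omega

end Cylinder

/-! ### Counting the return words -/

theorem Regular.exists_T_pow_mem_cylinder {E : IntervalExchange k} (hE : E.Regular) (hk : 2 ≤ k)
    {w : List (Fin k)} {c : Set.Ico (0 : ℝ) 1} (hc : c ∈ E.cylinder w) (x : Set.Ico (0 : ℝ) 1)
    (N : ℕ) : (∃ n, N ≤ n ∧ (E.T ^ n) x ∈ E.cylinder w) ∧
      ∃ n, N ≤ n ∧ (E.inv.T ^ n) x ∈ E.cylinder w := by
  obtain ⟨ε, hε, h1, h⟩ := E.exists_agree_right c w.length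
  constructor
  · obtain ⟨n, hn⟩ := hE.exists_T_pow_mem_Ioo hk ((E.T ^ N) x) c.2.1
      (show (c : ℝ) < c + ε by linarith) h1
    rw [← T_pow_add_apply] at hn
    exact ⟨n + N, by omega, (h _ hn.1.le hn.2).mem_cylinder hc⟩
  · obtain ⟨n, hn⟩ := hE.inv.exists_T_pow_mem_Ioo hk ((E.inv.T ^ N) x) c.2.1
      (show (c : ℝ) < c + ε by linarith) h1
    rw [← T_pow_add_apply] at hn
    exact ⟨n + N, by omega, (h _ hn.1.le hn.2).mem_cylinder hc⟩

theorem Regular.encard_returnWords {E : IntervalExchange k} (hE : E.Regular) (hk : 2 ≤ k)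
    {w : List (Fin k)} {y₀ : Set.Ico (0 : ℝ) 1} (hy₀ : y₀ ∈ E.cylinder w)
    (x : Set.Ico (0 : ℝ) 1) : (returnWords (E.word x) w).encard = k := by
  classical
  have hret : ∀ y, ∃ r, 0 < r ∧ (E.T ^ r) y ∈ E.cylinder w :=
    fun y => (hE.exists_T_pow_mem_cylinder hk hy₀ y 1).1
  have hcut : ∀ i : Fin k, ∃ m, w.length ≤ m ∧ (E.inv.T ^ m) (E.leftPt i) ∈ E.cylinder w :=
    fun i => (hE.exists_T_pow_mem_cylinder hk hy₀ _ _).2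
  obtain ⟨c, hc, hmin, q, l, hql, hql', hcl⟩ := exists_least_cylinder hy₀
  let p : Fin k → Set.Ico (0 : ℝ) 1 := fun i => if (i : ℕ) = 0 then c else E.cutPt w i
  have hp0 : ∀ i : Fin k, (i : ℕ) = 0 → p i = c := fun i hi => if_pos hi
  have hp1 : ∀ i : Fin k, (i : ℕ) ≠ 0 → p i = E.cutPt w i := fun i hi => if_neg hi
  have hpmem : ∀ i, p i ∈ E.cylinder w := by
    intro i
    by_cases hi : (i : ℕ) = 0
    · rwa [hp0 i hi]
    · rw [hp1 i hi]
      exact (cutTime_spec (hcut i)).2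
  -- The least point reaches endpoint `l` at time `q ≤ |w|`, no later than a cut reaches its own.
  -- Different times would connect two endpoints. Equal times force `q = |w|`, hence `l = 0`,
  -- whereas `i ≠ 0`.
  have hcne : ∀ i : Fin k, (i : ℕ) ≠ 0 → E.cutPt w i ≠ c := by
    intro i hi h
    have h1 := E.T_pow_cutPt w i
    have h2 := (cutTime_spec (hcut i)).1
    rw [h, show E.cutTime w i = (E.cutTime w i - q) + q by omega, T_pow_add_apply, hcl] at h1
    by_cases h3 : E.cutTime w i - q = 0
    · rw [h3] at h1
      have h4 : l = i := E.leftPt_injective h1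
      subst h4
      rcases hql' with h5 | h5
      · omega
      · exact hi h5
    · exact hE.T_pow_leftPt_ne hi h3 h1
  have hinj : Function.Injective p := by
    have hne : ∀ i j : Fin k, (i : ℕ) ≠ 0 → (j : ℕ) ≠ 0 → E.cutTime w i ≤ E.cutTime w j →
        E.cutPt w i = E.cutPt w j → i = j := by
      intro i j hi hj hle h
      have h1 := E.T_pow_cutPt w j
      rw [← h, ← Nat.sub_add_cancel hle, T_pow_add_apply, T_pow_cutPt] at h1
      exact (hE.pow hi hj h1).2
    intro i j h
    by_cases hi : (i : ℕ) = 0 <;> by_cases hj : (j : ℕ) = 0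
    · exact Fin.ext (hi.trans hj.symm)
    · rw [hp0 i hi, hp1 j hj] at h
      exact absurd h.symm (hcne j hj)
    · rw [hp1 i hi, hp0 j hj] at h
      exact absurd h (hcne i hi)
    · rw [hp1 i hi, hp1 j hj] at h
      rcases le_total (E.cutTime w i) (E.cutTime w j) with hle | hle
      · exact hne i j hi hj hle h
      · exact (hne j i hj hi hle h.symm).symm
  have hconst : ∀ (i : Fin k) (y : Set.Ico (0 : ℝ) 1), y ∈ E.cylinder w → (p i : ℝ) ≤ y →
      (∀ j, (p i : ℝ) < p j → ¬ (p j : ℝ) ≤ y) → E.returnWord w (p i) = E.returnWord w y := by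
    intro i y hy hle hno
    refine returnWord_eq_of_le hret hcut (hpmem i) hy hle fun j hj => ?_
    rw [← hp1 j hj]
    exact hno j
  have hgne : ∀ i j, (p i : ℝ) < p j → E.returnWord w (p i) ≠ E.returnWord w (p j) := by
    intro i j hlt
    have hj : (j : ℕ) ≠ 0 := fun h => by
      rw [hp0 j h] at hlt
      exact absurd (hmin _ (hpmem i)) (not_le.2 hlt)
    refine returnWord_ne_of_cutPt hret (j := j) ?_ ?_
    · rwa [← hp1 j hj]
    · rw [← hp1 j hj]
  have hginj : Function.Injective fun i => E.returnWord w (p i) := by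
    intro i j h
    apply hinj
    apply Subtype.ext
    rcases lt_trichotomy (p i : ℝ) (p j) with hlt | heq | hlt
    · exact absurd h (hgne i j hlt)
    · exact heq
    · exact absurd h.symm (hgne j i hlt)
  have hrange : returnWords (E.word x) w = Set.range fun i => E.returnWord w (p i) := by
    rw [returnWords_word hret]
    ext v
    constructor
    · rintro ⟨m, hm, rfl⟩
      obtain ⟨i, hi, hmax⟩ := (Finset.univ.filter fun i =>
        (p i : ℝ) ≤ ((E.T ^ m) x : Set.Ico (0 : ℝ) 1)).exists_max_image (fun i => (p i : ℝ))
        ⟨⟨0, by omega⟩, by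
          rw [Finset.mem_filter, hp0 _ rfl]
          exact ⟨Finset.mem_univ _, hmin _ hm⟩⟩
      simp only [Finset.mem_filter, Finset.mem_univ, true_and] at hi hmax
      exact ⟨i, hconst i _ hm hi fun j hij hj => absurd (hmax j hj) (not_le.2 hij)⟩
    · rintro ⟨i, rfl⟩
      obtain ⟨ε, hε, h1, h⟩ := E.exists_agree_right (p i) w.length
      -- After reflection, `g` bounds from below the distance from `p i` to the next point `p j` on
      -- its right. An orbit point within `min ε g` of `p i` is then in the same piece.
      obtain ⟨g, hg, hfree⟩ := (Set.finite_range fun j => -(p j : ℝ)).exists_freeLeft (-(p i))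
      obtain ⟨m, hm⟩ := hE.exists_T_pow_mem_Ioo hk x (p i).2.1
        (show (p i : ℝ) < p i + min ε g by linarith [lt_min hε hg])
        (by linarith [min_le_left ε g])
      have hmw := (h _ hm.1.le (by linarith [min_le_left ε g, hm.2])).mem_cylinder (hpmem i)
      refine ⟨m, hmw, hconst i _ hmw hm.1.le fun j hij hj => ?_⟩
      have := hfree _ ⟨j, rfl⟩ (neg_lt_neg hij)
      linarith [min_le_right ε g, hm.2]
  rw [hrange, ← Set.image_univ, hginj.encard_image, Set.encard_univ]
  simp

end IntervalExchange

theorem theorem2 {k : ℕ} (E : IntervalExchange k) (hE : E.Regular) (x : Set.Ico (0 : ℝ) 1) :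
    InfiniteWord.PropertyR k (E.word x) := by
  -- For `k = 1` the map is the identity and density fails, so this case is treated on the words
  -- themselves.
  obtain rfl | rfl | hk : k = 0 ∨ k = 1 ∨ 2 ≤ k := by omega
  · exact (E.code x).elim0
  · exact InfiniteWord.propertyR_one _
  · have hmem : ∀ w ∈ InfiniteWord.language (E.word x), ∃ y, y ∈ E.cylinder w := by
      rintro w ⟨i, hi⟩
      exact ⟨_, (E.mem_positions_word x w i).1 hi⟩
    refine ⟨fun w hw => ?_, fun w hw => ?_⟩
    · obtain ⟨y, hy⟩ := hmem w hw
      refine Set.infinite_of_not_bddAbove fun ⟨N, hN⟩ => ?_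
      obtain ⟨n, hn, hnw⟩ := (hE.exists_T_pow_mem_cylinder hk hy x (N + 1)).1
      have := hN ((E.mem_positions_word x w n).2 hnw)
      omega
    · obtain ⟨y, hy⟩ := hmem w hw
      exact hE.encard_returnWords hk hy x
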